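/- All graphs are finite and simple. A polyhedron is a planar, $3$-connected graph (a graph is $3$-connected if it has at least $4$ vertices and remains connected after the removal of any set of at most $2$ vertices). For a graph $G$ let \[A(G)=\{\,|N(u)\cap N(v)| : u,v\in V(G),\ u\neq v\,\},\] where $N(u)$ denotes the set of neighbours of $u$. Proposition. For every finite non-empty set $A'_3$ of integers $\geq 3$, there are infinitely many pairwise non-isomorphic polyhedra $G$ satisfying \[A(G)=\{0,1,2\}\cup A'_3.\] -/

import Mathlib

namespace SimpleGraph

/-- The Euclidean plane. -/
abbrev Plane : Type := EuclideanSpace ℝ (Fin 2)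

/-- `s` is a simple arc in the plane with end points `a` and `b`: the image of an injective
continuous path from `a` to `b`. -/
def IsSimpleArc (s : Set Plane) (a b : Plane) : Prop :=
  ∃ γ : _root_.Path a b, Function.Injective γ ∧ Set.range γ = s

/-- An embedding of a graph in the plane: distinct vertices are distinct points, every edge is a
simple arc that joins its two end vertices and passes through no other vertex, and two different
edges meet only at vertices. The value of `arc` off the edge set is irrelevant. -/
structure PlaneEmbedding {V : Type*} (G : SimpleGraph V) where
  pos : V → Plane
  pos_injective : Function.Injective pos
  arc : Sym2 V → Set Plane
  arc_isSimpleArc : ∀ u v : V, G.Adj u v → IsSimpleArc (arc s(u, v)) (pos u) (pos v)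
  mem_of_pos_mem_arc : ∀ e ∈ G.edgeSet, ∀ w : V, pos w ∈ arc e → w ∈ e
  arc_inter_arc : ∀ e ∈ G.edgeSet, ∀ f ∈ G.edgeSet, e ≠ f → arc e ∩ arc f ⊆ Set.range pos

/-- A graph is planar if it can be embedded in the plane. -/
def IsPlanar {V : Type*} (G : SimpleGraph V) : Prop :=
  Nonempty (PlaneEmbedding G)

/-- A finite graph is `k`-connected if it has at least `k + 1` vertices and it remains connected
whenever fewer than `k` vertices are removed. -/
def IsVertexConnected {V : Type*} [Fintype V] (k : ℕ) (G : SimpleGraph V) : Prop :=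
  k + 1 ≤ Fintype.card V ∧
    ∀ S : Finset V, S.card < k → (G.induce {v : V | v ∉ S}).Connected

/-- A polyhedron is a (finite) planar, `3`-connected graph. -/
def IsPolyhedron {V : Type*} [Fintype V] (G : SimpleGraph V) : Prop :=
  G.IsPlanar ∧ G.IsVertexConnected 3

/-- The type `A(G)` of a graph: the set of the numbers of common neighbours of all pairs of
distinct vertices. -/
def commonNeighborType {V : Type*} (G : SimpleGraph V) : Set ℕ :=
  {a : ℕ | ∃ u v : V, u ≠ v ∧ (G.commonNeighbors u v).ncard = a}

end SimpleGraph

namespace SimpleGraph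

/-! ### Straight-line drawings on horizontal layers -/

/-! A path of `m` hubs lies below a rim path, with one apex above it. Rim vertices of residue 0 mod
3 see both the apex and a hub, those of residue 1 only the apex, those of residue 2 only a hub. The
apex and hub `j` thus share exactly the vertices `3 * i` with `b i = j`, so block sizes become type
values, while every other pair shares at most two vertices (`ncard_commonNeighbors_le_two`).
Monotonicity of `b` makes a three-row straight-line drawing crossing-free
(`LayeredDrawing.isPlanar`), and blocks of size at least 3 give 3-connectedness. Repeating block
sizes yields arbitrarily large graphs of the same type. -/

theorem isSimpleArc_segment {a b : Plane} (h : a ≠ b) : IsSimpleArc (segment ℝ a b) a b := by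
  refine ⟨⟨⟨fun t => AffineMap.lineMap a b (t : ℝ), by
    simp only [AffineMap.lineMap_apply_module]; fun_prop⟩, by simp, by simp⟩, ?_, ?_⟩
  · intro s t hst
    exact Subtype.ext (AffineMap.lineMap_injective ℝ h hst)
  · rw [segment_eq_image_lineMap]
    ext p
    constructor
    · rintro ⟨t, rfl⟩
      exact ⟨t, t.2, rfl⟩
    · rintro ⟨t, ht, rfl⟩
      exact ⟨⟨t, ht⟩, rfl⟩

/-- The point of the plane with the given integer coordinates. -/
noncomputable def gridPoint (x y : ℤ) : Plane := !₂[(x : ℝ), (y : ℝ)]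

theorem eq_gridPoint {p : Plane} {x y : ℤ} (hx : p 0 = x) (hy : p 1 = y) : p = gridPoint x y := by
  ext i
  fin_cases i <;> simp [gridPoint, hx, hy]

theorem exists_of_mem_segment_gridPoint {p : Plane} {x y x' y' : ℤ}
    (h : p ∈ segment ℝ (gridPoint x y) (gridPoint x' y')) :
    ∃ τ : ℝ, 0 ≤ τ ∧ τ ≤ 1 ∧ p 0 = x + τ * (x' - x) ∧ p 1 = y + τ * (y' - y) := by
  rw [segment_eq_image_lineMap] at h
  obtain ⟨τ, ⟨h0, h1⟩, rfl⟩ := h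
  refine ⟨τ, h0, h1, ?_, ?_⟩ <;>
    simp [gridPoint, AffineMap.lineMap_apply_module] <;> ring

/-- A straight-line drawing with the vertices at integer points, in which every edge joins
consecutive points of a row or two points of consecutive rows, and no two edges between the same
rows cross. -/
structure LayeredDrawing {V : Type*} (G : SimpleGraph V) where
  row : V → ℤ
  col : V → ℤ
  eq_of_row_col : ∀ u v, row u = row v → col u = col v → u = v
  adj_cases : ∀ u v, G.Adj u v → (row v = row u ∧ col v = col u + 1) ∨
    (row u = row v ∧ col u = col v + 1) ∨ row v = row u + 1 ∨ row u = row v + 1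
  col_le : ∀ u v u' v', G.Adj u v → G.Adj u' v' → row v = row u + 1 → row v' = row u' + 1 →
    row u = row u' → col u < col u' → col v ≤ col v'

namespace LayeredDrawing

variable {V : Type*} {G : SimpleGraph V} (D : G.LayeredDrawing)

/-- The position of a vertex in a layered drawing. -/
noncomputable def pos (v : V) : Plane := gridPoint (D.col v) (D.row v)

/-- The segment that represents an edge in a layered drawing. -/
noncomputable def arc : Sym2 V → Set Plane :=
  Sym2.lift ⟨fun u v => segment ℝ (D.pos u) (D.pos v), fun _ _ => segment_symm ℝ _ _⟩

theorem pos_injective : Function.Injective D.pos := by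
  intro u v h
  have h0 := congrArg (fun p : Plane => p 0) h
  have h1 := congrArg (fun p : Plane => p 1) h
  simp only [pos, gridPoint, PiLp.toLp_apply, Matrix.cons_val_zero, Matrix.cons_val_one,
    Int.cast_inj] at h0 h1
  exact D.eq_of_row_col u v h1 h0

theorem exists_oriented {e : Sym2 V} (he : e ∈ G.edgeSet) : ∃ u v, e = s(u, v) ∧ G.Adj u v ∧
    ((D.row v = D.row u ∧ D.col v = D.col u + 1) ∨ D.row v = D.row u + 1) := by
  induction e with
  | _ u v =>
    have h : G.Adj u v := he
    rcases D.adj_cases u v h with h' | h' | h' | h'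
    · exact ⟨u, v, rfl, h, .inl h'⟩
    · exact ⟨v, u, Sym2.eq_swap, h.symm, .inl h'⟩
    · exact ⟨u, v, rfl, h, .inr h'⟩
    · exact ⟨v, u, Sym2.eq_swap, h.symm, .inr h'⟩

theorem mem_range_of_eq {p : Plane} {v : V} (hx : p 0 = D.col v) (hy : p 1 = D.row v) :
    p ∈ Set.range D.pos :=
  ⟨v, (eq_gridPoint hx hy).symm⟩

theorem mem_of_pos_mem_arc {e : Sym2 V} (he : e ∈ G.edgeSet) {w : V} (hw : D.pos w ∈ D.arc e) :
    w ∈ e := by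
  obtain ⟨u, v, rfl, -, h⟩ := D.exists_oriented he
  obtain ⟨τ, h0, h1, hx, hy⟩ := exists_of_mem_segment_gridPoint hw
  simp only [pos, gridPoint, PiLp.toLp_apply, Matrix.cons_val_zero, Matrix.cons_val_one] at hx hy
  rw [Sym2.mem_iff]
  rcases h with ⟨hr, hc⟩ | hr
  · rw [hr, sub_self, mul_zero, add_zero, Int.cast_inj] at hy
    rw [hc] at hx
    push_cast at hx
    have a1 : D.col u ≤ D.col w := by
      have : (D.col u : ℝ) ≤ D.col w := by linarith
      exact_mod_cast this
    have a2 : D.col w ≤ D.col u + 1 := by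
      have : (D.col w : ℝ) ≤ D.col u + 1 := by linarith
      exact_mod_cast this
    rcases (by omega : D.col w = D.col u ∨ D.col w = D.col u + 1) with h | h
    · exact .inl (D.eq_of_row_col _ _ hy h)
    · exact .inr (D.eq_of_row_col _ _ (hy.trans hr.symm) (h.trans hc.symm))
  · rw [hr] at hy
    push_cast at hy
    have a1 : D.row u ≤ D.row w := by
      have : (D.row u : ℝ) ≤ D.row w := by linarith
      exact_mod_cast this
    have a2 : D.row w ≤ D.row u + 1 := by
      have : (D.row w : ℝ) ≤ D.row u + 1 := by linarith
      exact_mod_cast this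
    rcases (by omega : D.row w = D.row u ∨ D.row w = D.row u + 1) with h | h
    · have hτ : τ = 0 := by rw [h] at hy; linarith
      rw [hτ, zero_mul, add_zero, Int.cast_inj] at hx
      exact .inl (D.eq_of_row_col _ _ h hx)
    · have hτ : τ = 1 := by rw [h] at hy; push_cast at hy; linarith
      rw [hτ, one_mul, add_sub_cancel, Int.cast_inj] at hx
      exact .inr (D.eq_of_row_col _ _ (h.trans hr.symm) hx)

/-- Edges in different strips meet only at integer heights, hence at ends. In one strip equal height
means equal parameter `τ`; the horizontal gap is at least 1 below and nonnegative above, so it can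
vanish only at `τ = 1`. -/
theorem arc_inter_arc {e f : Sym2 V} (he : e ∈ G.edgeSet) (hf : f ∈ G.edgeSet) (hef : e ≠ f) :
    D.arc e ∩ D.arc f ⊆ Set.range D.pos := by
  rintro p ⟨hpe, hpf⟩
  obtain ⟨u, v, rfl, huv, h⟩ := D.exists_oriented he
  obtain ⟨u', v', rfl, huv', h'⟩ := D.exists_oriented hf
  obtain ⟨τ, h0, h1, hx, hy⟩ := exists_of_mem_segment_gridPoint hpe
  obtain ⟨σ, k0, k1, kx, ky⟩ := exists_of_mem_segment_gridPoint hpf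
  have start_e : τ = 0 → p ∈ Set.range D.pos := fun hτ =>
    D.mem_range_of_eq (v := u) (by rw [hx, hτ]; ring) (by rw [hy, hτ]; ring)
  have end_e : τ = 1 → p ∈ Set.range D.pos := fun hτ =>
    D.mem_range_of_eq (v := v) (by rw [hx, hτ]; ring) (by rw [hy, hτ]; ring)
  have start_f : σ = 0 → p ∈ Set.range D.pos := fun hτ =>
    D.mem_range_of_eq (v := u') (by rw [kx, hτ]; ring) (by rw [ky, hτ]; ring)
  have end_f : σ = 1 → p ∈ Set.range D.pos := fun hτ =>
    D.mem_range_of_eq (v := v') (by rw [kx, hτ]; ring) (by rw [ky, hτ]; ring)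
  have cast_lt : ∀ {a b : ℤ}, a < b → (a : ℝ) + 1 ≤ b := fun h => by exact_mod_cast h
  rw [hx] at kx
  rw [hy] at ky
  rcases h with ⟨hr, hc⟩ | hr <;> rcases h' with ⟨hr', hc'⟩ | hr' <;>
    rw [hr, hr'] at ky <;> push_cast at ky
  · have hrow : D.row u = D.row u' := by
      have : (D.row u : ℝ) = D.row u' := by linarith
      exact_mod_cast this
    rw [hc, hc'] at kx
    push_cast at kx
    rcases lt_trichotomy (D.col u) (D.col u') with hl | hl | hl
    · exact end_e (by linarith [cast_lt hl])
    · have hu := D.eq_of_row_col _ _ hrow hl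
      have hv := D.eq_of_row_col v v' (by rw [hr, hr', hrow]) (by rw [hc, hc', hl])
      exact absurd (by rw [hu, hv]) hef
    · exact start_e (by linarith [cast_lt hl])
  · rcases lt_trichotomy (D.row u) (D.row u') with hl | hl | hl
    · linarith [cast_lt hl]
    · rw [hl] at ky
      exact start_f (by linarith)
    · exact end_f (by linarith [cast_lt hl])
  · rcases lt_trichotomy (D.row u') (D.row u) with hl | hl | hl
    · linarith [cast_lt hl]
    · rw [hl] at ky
      exact start_e (by linarith)
    · exact end_e (by linarith [cast_lt hl])
  · rcases lt_trichotomy (D.row u) (D.row u') with hl | hl | hl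
    · exact end_e (by linarith [cast_lt hl])
    · rw [hl] at ky
      obtain rfl : τ = σ := by linarith
      rcases lt_trichotomy (D.col u) (D.col u') with hc | hc | hc
      · have hle : (D.col v : ℝ) ≤ D.col v' := by
          exact_mod_cast D.col_le u v u' v' huv huv' hr hr' hl hc
        refine end_e (le_antisymm h1 ?_)
        nlinarith [cast_lt hc, mul_nonneg h0 (sub_nonneg.2 hle),
          mul_nonneg (sub_nonneg.2 h1) (sub_nonneg.2 (cast_lt hc))]
      · have hu := D.eq_of_row_col _ _ hl hc
        have hne : (D.col v : ℝ) ≠ D.col v' := by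
          intro hv
          refine hef ?_
          rw [hu, D.eq_of_row_col v v' (by rw [hr, hr', hl]) (by exact_mod_cast hv)]
        rw [hc] at kx
        have : τ * ((D.col v : ℝ) - D.col v') = 0 := by linarith
        rcases mul_eq_zero.1 this with h | h
        · exact start_e h
        · exact absurd (sub_eq_zero.1 h) hne
      · have hle : (D.col v' : ℝ) ≤ D.col v := by
          exact_mod_cast D.col_le u' v' u v huv' huv hr' hr hl.symm hc
        refine end_e (le_antisymm h1 ?_)
        nlinarith [cast_lt hc, mul_nonneg h0 (sub_nonneg.2 hle),
          mul_nonneg (sub_nonneg.2 h1) (sub_nonneg.2 (cast_lt hc))]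
    · exact start_e (by linarith [cast_lt hl])

theorem isPlanar (D : G.LayeredDrawing) : G.IsPlanar :=
  ⟨{ pos := D.pos
     pos_injective := D.pos_injective
     arc := D.arc
     arc_isSimpleArc := fun _ _ h => isSimpleArc_segment (D.pos_injective.ne h.ne)
     mem_of_pos_mem_arc := fun _ he _ hw => D.mem_of_pos_mem_arc he hw
     arc_inter_arc := fun _ he _ hf hef => D.arc_inter_arc he hf hef }⟩

end LayeredDrawing

/-! ### Invariance under isomorphism -/

section Iso

variable {V W : Type*} {G : SimpleGraph V} {H : SimpleGraph W}

theorem Iso.isPlanar (φ : G ≃g H) (h : G.IsPlanar) : H.IsPlanar := by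
  obtain ⟨E⟩ := h
  have hmem : ∀ e ∈ H.edgeSet, e.map φ.symm ∈ G.edgeSet := fun e he => by
    induction e with
    | _ u v => exact φ.symm.map_adj_iff.2 he
  refine ⟨{
    pos := E.pos ∘ φ.symm
    pos_injective := E.pos_injective.comp φ.symm.injective
    arc := fun e => E.arc (e.map φ.symm)
    arc_isSimpleArc := fun u v h => E.arc_isSimpleArc _ _ (φ.symm.map_adj_iff.2 h)
    mem_of_pos_mem_arc := fun e he w hw => ?_
    arc_inter_arc := fun e he f hf hef => ?_ }⟩
  · have := E.mem_of_pos_mem_arc _ (hmem e he) _ hw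
    obtain ⟨x, hx, hxw⟩ := Sym2.mem_map.1 this
    rwa [φ.symm.injective hxw] at hx
  · rw [φ.symm.surjective.range_comp]
    exact E.arc_inter_arc _ (hmem e he) _ (hmem f hf)
      fun h => hef (Sym2.map.injective φ.symm.injective h)

theorem Iso.isVertexConnected [Fintype V] [Fintype W] (φ : G ≃g H) {k : ℕ}
    (h : G.IsVertexConnected k) : H.IsVertexConnected k := by
  classical
  refine ⟨(Fintype.card_congr φ.toEquiv) ▸ h.1, fun S hS => ?_⟩
  have hc := h.2 (S.map φ.symm.toEquiv.toEmbedding) (by rwa [Finset.card_map])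
  have hmem : ∀ x, x ∉ S.map φ.symm.toEquiv.toEmbedding → φ x ∉ S := fun x hx hxS =>
    hx (Finset.mem_map.2 ⟨_, hxS, φ.symm_apply_apply _⟩)
  let f : G.induce {v | v ∉ S.map φ.symm.toEquiv.toEmbedding} →g H.induce {v | v ∉ S} :=
    ⟨fun x => ⟨φ x.1, hmem x.1 x.2⟩, fun {_ _} hab => φ.map_adj_iff.2 hab⟩
  refine hc.map (f := f) ?_
  rintro ⟨w, hw⟩
  refine ⟨⟨φ.symm w, fun hx => hw ?_⟩, Subtype.ext (φ.apply_symm_apply w)⟩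
  obtain ⟨y, hy, hyw⟩ := Finset.mem_map.1 hx
  rwa [φ.symm.injective hyw] at hy

theorem Iso.commonNeighborType_subset (φ : G ≃g H) :
    G.commonNeighborType ⊆ H.commonNeighborType := by
  rintro _ ⟨u, v, huv, rfl⟩
  refine ⟨φ u, φ v, φ.injective.ne huv, ?_⟩
  rw [← Set.ncard_image_of_injective (G.commonNeighbors u v) φ.injective]
  congr 1
  ext w
  obtain ⟨x, rfl⟩ := φ.surjective w
  rw [φ.injective.mem_set_image]
  simp only [mem_commonNeighbors, φ.map_adj_iff]

theorem Iso.commonNeighborType_eq (φ : G ≃g H) :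
    G.commonNeighborType = H.commonNeighborType :=
  φ.commonNeighborType_subset.antisymm φ.symm.commonNeighborType_subset

end Iso

end SimpleGraph

/-! ### Blocks of a monotone sequence -/

/-- A monotone sequence with prescribed block sizes. -/
theorem exists_monotone_ncard_fiber (a : ℕ → ℕ) (m : ℕ) :
    ∃ b : ℕ → ℕ, Monotone b ∧ (∀ i < ∑ j ∈ Finset.range m, a j, b i < m) ∧
      ∀ j < m, {i | i < ∑ j ∈ Finset.range m, a j ∧ b i = j}.ncard = a j := by
  induction m with
  | zero => exact ⟨fun _ => 0, fun _ _ _ => le_rfl, by simp, by simp⟩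
  | succ m ih =>
    obtain ⟨b, hb, hlt, hcard⟩ := ih
    rw [Finset.sum_range_succ]
    generalize ∑ j ∈ Finset.range m, a j = N at hlt hcard ⊢
    -- The value `m` past `N` adds the new block and keeps the sequence monotone on all of `ℕ`.
    refine ⟨fun i => if i < N then b i else m, fun i k hik => ?_, fun i _ => ?_, fun j hj => ?_⟩
    · dsimp only
      split_ifs with h h' h'
      · exact hb hik
      · exact (hlt i h).le
      · omega
      · exact le_rfl
    · dsimp only
      split_ifs with h
      · exact (hlt i h).trans (Nat.lt_succ_self m)
      · exact Nat.lt_succ_self m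
    · rcases Nat.lt_succ_iff_lt_or_eq.1 hj with hj | rfl
      · rw [← hcard j hj]
        congr 1
        ext i
        simp only [Set.mem_ofPred_eq]
        split_ifs with h
        · simp [h, Nat.lt_add_right]
        · simp only [h, false_and, iff_false, not_and]
          exact fun _ => hj.ne'
      · have : {i | i < N + a j ∧ (if i < N then b i else j) = j} = Set.Ico N (N + a j) := by
          ext i
          simp only [Set.mem_ofPred_eq, Set.mem_Ico]
          split_ifs with h
          · have := hlt i h
            omega
          · omega
        rw [this, ← Finset.coe_Ico, Set.ncard_coe_finset, Nat.card_Ico]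
        omega

namespace SimpleGraph

/-! ### The block graphs -/

/-- The vertices of the block graph: an apex, a path of `3 * n + 1` rim vertices and a path of `m`
hubs. -/
inductive BlockVertex (n m : ℕ) : Type
  | apex : BlockVertex n m
  | rim (t : Fin (3 * n + 1)) : BlockVertex n m
  | hub (j : Fin m) : BlockVertex n m

namespace BlockVertex

variable {n m : ℕ}

/-- The block vertices as a sum type. -/
def equivSum : BlockVertex n m ≃ Unit ⊕ Fin (3 * n + 1) ⊕ Fin m where
  toFun
    | apex => .inl ()
    | rim t => .inr (.inl t)
    | hub j => .inr (.inr j)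
  invFun
    | .inl _ => apex
    | .inr (.inl t) => rim t
    | .inr (.inr j) => hub j
  left_inv v := by cases v <;> rfl
  right_inv v := by rcases v with _ | _ | _ <;> rfl

instance : Fintype (BlockVertex n m) := Fintype.ofEquiv _ equivSum.symm

theorem card_eq : Fintype.card (BlockVertex n m) = 1 + (3 * n + 1 + m) := by
  simp [Fintype.card_congr (equivSum (n := n) (m := m))]

/-- The adjacency relation of the block graph. -/
def Adj (b : ℕ → ℕ) : BlockVertex n m → BlockVertex n m → Prop
  | apex, rim t => t.val % 3 ≠ 2
  | rim t, apex => t.val % 3 ≠ 2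
  | rim s, rim t => s.val + 1 = t.val ∨ t.val + 1 = s.val
  | rim t, hub j => t.val % 3 ≠ 1 ∧ b ((t.val + 1) / 3) = j.val
  | hub j, rim t => t.val % 3 ≠ 1 ∧ b ((t.val + 1) / 3) = j.val
  | hub i, hub j => i.val + 1 = j.val ∨ j.val + 1 = i.val
  | _, _ => False

end BlockVertex

open BlockVertex

/-- The block graph of a sequence `b`: a path of rim vertices and a path of hubs, where of every
three successive rim vertices `3 * i - 1, 3 * i, 3 * i + 1` the latter two are joined to the apex
and the former two to the hub `b i`. -/
def blockGraph (n m : ℕ) (b : ℕ → ℕ) : SimpleGraph (BlockVertex n m) where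
  Adj := BlockVertex.Adj b
  symm := ⟨fun u v h => by cases u <;> cases v <;> simp only [BlockVertex.Adj] at h ⊢ <;> tauto⟩
  loopless := ⟨fun v h => by cases v <;> simp [BlockVertex.Adj] at h⟩

namespace blockGraph

variable {n m : ℕ} {b : ℕ → ℕ}

@[simp] theorem not_adj_apex_apex : ¬ (blockGraph n m b).Adj apex apex := id

@[simp] theorem not_adj_apex_hub (j : Fin m) : ¬ (blockGraph n m b).Adj apex (hub j) := id

@[simp] theorem not_adj_hub_apex (j : Fin m) : ¬ (blockGraph n m b).Adj (hub j) apex := id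

@[simp] theorem adj_apex_rim (t : Fin (3 * n + 1)) :
    (blockGraph n m b).Adj apex (rim t) ↔ t.val % 3 ≠ 2 := Iff.rfl

@[simp] theorem adj_rim_apex (t : Fin (3 * n + 1)) :
    (blockGraph n m b).Adj (rim t) apex ↔ t.val % 3 ≠ 2 := Iff.rfl

@[simp] theorem adj_rim_rim (s t : Fin (3 * n + 1)) :
    (blockGraph n m b).Adj (rim s) (rim t) ↔ s.val + 1 = t.val ∨ t.val + 1 = s.val := Iff.rfl

@[simp] theorem adj_rim_hub (t : Fin (3 * n + 1)) (j : Fin m) :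
    (blockGraph n m b).Adj (rim t) (hub j) ↔ t.val % 3 ≠ 1 ∧ b ((t.val + 1) / 3) = j.val := Iff.rfl

@[simp] theorem adj_hub_rim (t : Fin (3 * n + 1)) (j : Fin m) :
    (blockGraph n m b).Adj (hub j) (rim t) ↔ t.val % 3 ≠ 1 ∧ b ((t.val + 1) / 3) = j.val := Iff.rfl

@[simp] theorem adj_hub_hub (i j : Fin m) :
    (blockGraph n m b).Adj (hub i) (hub j) ↔ i.val + 1 = j.val ∨ j.val + 1 = i.val := Iff.rfl

/-- The drawing with the hubs, the rim and the apex in three rows. -/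
def layeredDrawing (n m : ℕ) (hb : Monotone b) : (blockGraph n m b).LayeredDrawing where
  row
    | apex => 2
    | rim _ => 1
    | hub _ => 0
  col
    | apex => 0
    | rim t => t.val
    | hub j => j.val
  eq_of_row_col u v hr hc := by
    cases u <;> cases v <;> simp [Fin.ext_iff] at hr hc ⊢ <;> omega
  adj_cases u v h := by
    cases u <;> cases v <;> simp at h ⊢ <;> omega
  col_le u v u' v' h h' hr hr' hrow hcol := by
    cases u <;> cases v <;> simp at h hr ⊢ <;> cases u' <;> cases v' <;>
      simp at h' hr' hrow hcol ⊢
    rename_i j s k t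
    -- Edges up to the apex share their upper end, so only hub–rim edges matter.
    have : (s.val + 1) / 3 < (t.val + 1) / 3 := hb.reflect_lt (by omega)
    omega

theorem ncard_commonNeighbors_apex_hub (j : Fin m) :
    ((blockGraph n m b).commonNeighbors apex (hub j)).ncard =
      {i | i < n + 1 ∧ b i = j}.ncard := by
  symm
  refine Set.ncard_congr (fun i hi => rim ⟨3 * i, by have := hi.1; omega⟩) ?_ ?_ ?_
  · rintro i ⟨hi, hij⟩
    simp only [mem_commonNeighbors, adj_apex_rim, adj_hub_rim]
    rw [show (3 * i + 1) / 3 = i by omega]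
    exact ⟨by omega, by omega, hij⟩
  · intro i k hi hk h
    simp only [rim.injEq, Fin.mk.injEq] at h
    omega
  · rintro (_ | t | k) ⟨h1, h2⟩
    · simp at h1
    · simp only [mem_neighborSet, adj_apex_rim, adj_hub_rim] at h1 h2
      have h3 : (t.val + 1) / 3 = t.val / 3 := by omega
      refine ⟨t.val / 3, ⟨by omega, h3 ▸ h2.2⟩, ?_⟩
      simp only [rim.injEq, Fin.ext_iff]
      omega
    · simp at h1

/-- Two rim vertices sharing both the apex and a hub have residue 0, so they are not at distance 2
on the rim. A rim vertex whose two rim neighbours both see hubs has residue 1 and sees no hub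
itself. Two hubs share no rim vertex. -/
theorem ncard_commonNeighbors_le_two {u v : BlockVertex n m} (huv : u ≠ v)
    (h : ∀ j, ¬ (u = apex ∧ v = hub j)) (h' : ∀ j, ¬ (v = apex ∧ u = hub j)) :
    ((blockGraph n m b).commonNeighbors u v).ncard ≤ 2 := by
  by_contra! hlt
  obtain ⟨x, y, z, ⟨hx, hx'⟩, ⟨hy, hy'⟩, ⟨hz, hz'⟩, hxy, hxz, hyz⟩ :=
    (Set.two_lt_ncard_iff (Set.toFinite _)).1 hlt
  rw [mem_neighborSet] at hx hx' hy hy' hz hz'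
  cases u <;> cases v <;> try first
    | exact absurd ⟨rfl, rfl⟩ (h _)
    | exact absurd ⟨rfl, rfl⟩ (h' _)
  all_goals
    simp [Fin.ext_iff] at huv <;>
    cases x <;> simp at hx hx' <;> cases y <;> simp [Fin.ext_iff] at hy hy' hxy <;>
    cases z <;> simp [Fin.ext_iff] at hz hz' hxz hyz <;> omega

theorem exists_notMem_of_card_lt_three {V : Type*} {S : Finset V} (hS : S.card < 3) {x y z : V}
    (hxy : x ≠ y) (hxz : x ≠ z) (hyz : y ≠ z) : x ∉ S ∨ y ∉ S ∨ z ∉ S := by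
  classical
  by_contra! h
  have : ({x, y, z} : Finset V) ⊆ S := by
    simp [Finset.insert_subset_iff, h]
  have := Finset.card_le_card this
  rw [Finset.card_eq_three.2 ⟨x, y, z, hxy, hxz, hyz, rfl⟩] at this
  omega

/-- Induction from a root along edges outside of a set of deleted vertices. -/
theorem induce_connected {V : Type*} {G : SimpleGraph V} {S : Finset V} {r : V} (hr : r ∉ S)
    (h : ∀ P : V → Prop, P r → (∀ v w, v ∉ S → G.Adj v w → P w → P v) → ∀ v ∉ S, P v) :
    (G.induce {v : V | v ∉ S}).Connected := by
  rw [connected_iff_exists_forall_reachable]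
  refine ⟨⟨r, hr⟩, fun ⟨v, hv⟩ => ?_⟩
  obtain ⟨_, hv'⟩ := h (fun v => ∃ hv : v ∉ S, (G.induce {v : V | v ∉ S}).Reachable ⟨r, hr⟩ ⟨v, hv⟩)
    ⟨hr, Reachable.refl _⟩ (fun v w hv hvw ⟨hw, hrw⟩ => ⟨hv, hrw.trans
      (Adj.reachable (G := G.induce {v : V | v ∉ S}) (u := ⟨w, hw⟩) (v := ⟨v, hv⟩) hvw.symm)⟩) v hv
  exact hv'

/-- If the apex survives, it is the root: each surviving hub reaches it through a surviving common
neighbour. Otherwise at most one more vertex is lost, so the rim path or the hub path is intact and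
serves as a spine. -/
theorem isVertexConnected_three (hlt : ∀ i < n + 1, b i < m)
    (hcard : ∀ j < m, 3 ≤ {i | i < n + 1 ∧ b i = j}.ncard) :
    (blockGraph n m b).IsVertexConnected 3 := by
  have hm : 0 < m := (Nat.zero_le _).trans_lt (hlt 0 (Nat.succ_pos n))
  have hn : 2 ≤ n := by
    have h1 := hcard 0 hm
    have h2 : {i | i < n + 1 ∧ b i = 0}.ncard ≤ (Set.Iio (n + 1)).ncard :=
      Set.ncard_le_ncard (fun i hi => hi.1) (Set.finite_Iio _)
    rw [← Finset.coe_Iio, Set.ncard_coe_finset, Nat.card_Iio] at h2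
    omega
  refine ⟨by rw [card_eq]; omega, fun S hS => ?_⟩
  have hhub : ∀ j : Fin m, ∃ t : Fin (3 * n + 1), rim t ∉ S ∧
      (blockGraph n m b).Adj apex (rim t) ∧ (blockGraph n m b).Adj (hub j) (rim t) := fun j => by
    obtain ⟨w, ⟨hw, hw'⟩, hwS⟩ := Set.exists_mem_notMem_of_ncard_lt_ncard
      (s := (S : Set (BlockVertex n m))) (t := (blockGraph n m b).commonNeighbors apex (hub j))
      (by
        rw [Set.ncard_coe_finset, ncard_commonNeighbors_apex_hub]
        exact hS.trans_le (hcard j j.2)) (Set.toFinite _)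
    rcases w with _ | t | k
    · simp at hw
    · exact ⟨t, hwS, hw, hw'⟩
    · simp at hw
  have hbt : ∀ t : Fin (3 * n + 1), b ((t.val + 1) / 3) < m := fun t => hlt _ (by omega)
  by_cases hapex : apex ∈ S
  · by_cases hS' : ∃ j, hub j ∈ S
    · obtain ⟨j, hj⟩ := hS'
      have hrim : ∀ t, rim t ∉ S := fun t => by
        rcases exists_notMem_of_card_lt_three hS (x := apex) (y := hub j) (z := rim t)
          (by simp) (by simp) (by simp) with h | h | h
        · exact absurd hapex h
        · exact absurd hj h
        · exact h
      refine induce_connected (hrim 0) fun P h0 hstep => ?_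
      have key : ∀ t (ht : t < 3 * n + 1), P (rim ⟨t, ht⟩) := by
        intro t
        induction t with
        | zero => exact fun _ => h0
        | succ t ih => exact fun ht => hstep _ _ (hrim _) (by simp) (ih (by omega))
      rintro (_ | t | k) hv
      · exact absurd hapex hv
      · exact key t t.2
      · obtain ⟨t, -, -, ht⟩ := hhub k
        exact hstep _ _ hv ht (key t t.2)
    · push Not at hS'
      refine induce_connected (hS' ⟨0, hm⟩) fun P h0 hstep => ?_
      have key : ∀ j (hj : j < m), P (hub ⟨j, hj⟩) := by
        intro j
        induction j with
        | zero => exact fun _ => h0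
        | succ j ih => exact fun hj => hstep _ _ (hS' _) (by simp) (ih (by omega))
      have key' : ∀ t : Fin (3 * n + 1), t.val % 3 ≠ 1 → rim t ∉ S → P (rim t) := fun t ht htS =>
        hstep _ _ htS (by simpa using ht) (key _ (hbt t))
      rintro (_ | t | k) hv
      · exact absurd hapex hv
      · by_cases ht : t.val % 3 = 1
        · rcases exists_notMem_of_card_lt_three hS (x := apex) (y := rim ⟨t.val - 1, by omega⟩)
            (z := rim ⟨t.val + 1, by omega⟩) (by simp) (by simp) (by simp) with h | h | h
          · exact absurd hapex h
          · exact hstep _ _ hv (by simp; omega) (key' _ (by simp; omega) h)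
          · exact hstep _ _ hv (by simp) (key' _ (by simp; omega) h)
        · exact key' t ht hv
      · exact key k k.2
  · refine induce_connected hapex fun P h0 hstep => ?_
    have key : ∀ t : Fin (3 * n + 1), t.val % 3 ≠ 2 → rim t ∉ S → P (rim t) := fun t ht htS =>
      hstep _ _ htS (by simpa using ht) h0
    have key' : ∀ j, hub j ∉ S → P (hub j) := fun j hj => by
      obtain ⟨t, htS, ht, ht'⟩ := hhub j
      exact hstep _ _ hj ht' (key t ht htS)
    rintro (_ | t | k) hv
    · exact h0
    · by_cases ht : t.val % 3 = 2
      · rcases exists_notMem_of_card_lt_three hS (x := hub ⟨_, hbt t⟩)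
          (y := rim ⟨t.val - 1, by omega⟩)
          (z := rim ⟨t.val + 1, by omega⟩) (by simp) (by simp) (by simp) with h | h | h
        · exact hstep _ _ hv (by simp; omega) (key' _ h)
        · exact hstep _ _ hv (by simp; omega) (key _ (by simp; omega) h)
        · exact hstep _ _ hv (by simp) (key _ (by simp; omega) h)
      · exact key t ht hv
    · exact key' k hv

theorem commonNeighborType_eq (hn : 2 ≤ n) :
    (blockGraph n m b).commonNeighborType =
      {0, 1, 2} ∪ {a | ∃ j < m, {i | i < n + 1 ∧ b i = j}.ncard = a} := by
  ext a
  constructor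
  · rintro ⟨u, v, huv, rfl⟩
    by_cases h : ∃ j, u = apex ∧ v = hub j
    · obtain ⟨j, rfl, rfl⟩ := h
      exact .inr ⟨j, j.2, (ncard_commonNeighbors_apex_hub j).symm⟩
    by_cases h' : ∃ j, v = apex ∧ u = hub j
    · obtain ⟨j, rfl, rfl⟩ := h'
      refine .inr ⟨j, j.2, ?_⟩
      rw [commonNeighbors_symm, ncard_commonNeighbors_apex_hub]
    push Not at h h'
    have := ncard_commonNeighbors_le_two (b := b) huv (by simpa using h) (by simpa using h')
    refine .inl ?_
    simp only [Set.mem_insert_iff, Set.mem_singleton_iff]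
    omega
  · rintro ((rfl | rfl | rfl) | ⟨j, hj, rfl⟩)
    · refine ⟨rim ⟨1, by omega⟩, rim ⟨2, by omega⟩, by simp, ?_⟩
      rw [Set.ncard_eq_zero]
      ext w
      rcases w with _ | t | j <;> simp only [mem_commonNeighbors, Set.mem_empty_iff_false,
        adj_rim_apex, adj_rim_rim, adj_rim_hub, iff_false] <;> omega
    · refine ⟨rim ⟨1, by omega⟩, rim ⟨4, by omega⟩, by simp, Set.ncard_eq_one.2 ⟨apex, ?_⟩⟩
      ext w
      rcases w with _ | t | j <;> simp only [mem_commonNeighbors, Set.mem_singleton_iff,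
        adj_rim_apex, adj_rim_rim, adj_rim_hub, reduceCtorEq, iff_false, iff_true] <;> omega
    · refine ⟨apex, rim ⟨2, by omega⟩, by simp, Set.ncard_eq_two.2
        ⟨rim ⟨1, by omega⟩, rim ⟨3, by omega⟩, by simp, ?_⟩⟩
      ext w
      rcases w with _ | t | j <;> simp only [mem_commonNeighbors, Set.mem_insert_iff,
        Set.mem_singleton_iff, not_adj_apex_apex, not_adj_apex_hub, adj_apex_rim, adj_rim_rim,
        reduceCtorEq, rim.injEq, Fin.ext_iff, false_and, or_self]
      all_goals omega
    · exact ⟨apex, hub ⟨j, hj⟩, by simp, ncard_commonNeighbors_apex_hub _⟩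

end blockGraph

/-! ### Realising the prescribed values -/

/-- For every sequence of block sizes there is a polyhedron with the expected type. -/
theorem exists_isPolyhedron_commonNeighborType (a : ℕ → ℕ) (ha : ∀ j, 3 ≤ a j) {m : ℕ}
    (hm : 0 < m) :
    ∃ G : SimpleGraph (Fin (3 * ∑ j ∈ Finset.range m, a j + m - 1)),
      G.IsPolyhedron ∧ G.commonNeighborType = {0, 1, 2} ∪ a '' Set.Iio m := by
  obtain ⟨b, hb, hlt, hcard⟩ := exists_monotone_ncard_fiber a m
  have h3 : 3 ≤ ∑ j ∈ Finset.range m, a j :=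
    (ha 0).trans (Finset.single_le_sum (fun _ _ => Nat.zero_le _) (Finset.mem_range.2 hm))
  -- The rim `0, …, 3 * n` contains `n + 1` multiples of 3, one per index of `b`.
  obtain ⟨n, hn⟩ : ∃ n, ∑ j ∈ Finset.range m, a j = n + 1 := ⟨_, (Nat.succ_pred (by omega)).symm⟩
  rw [hn] at hlt hcard h3 ⊢
  have e := (blockGraph n m b).overFinIso
    (show Fintype.card (BlockVertex n m) = 3 * (n + 1) + m - 1 by rw [BlockVertex.card_eq]; omega)
  refine ⟨_, ⟨e.isPlanar (blockGraph.layeredDrawing n m hb).isPlanar, e.isVertexConnected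
    (blockGraph.isVertexConnected_three hlt fun j hj => (hcard j hj).symm ▸ ha j)⟩, ?_⟩
  rw [← e.commonNeighborType_eq, blockGraph.commonNeighborType_eq (by omega)]
  congr 1
  ext x
  constructor
  · rintro ⟨j, hj, rfl⟩
    exact ⟨j, hj, (hcard j hj).symm⟩
  · rintro ⟨j, hj, rfl⟩
    exact ⟨j, hj, hcard j hj⟩

end SimpleGraph

theorem mainTheorem12 (A' : Finset ℕ) (hne : A'.Nonempty) (hA' : ∀ a ∈ A', 3 ≤ a) :
    ∃ (n : ℕ → ℕ) (G : (k : ℕ) → SimpleGraph (Fin (n k))),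
      (∀ k : ℕ, (G k).IsPolyhedron ∧ (G k).commonNeighborType = {0, 1, 2} ∪ (A' : Set ℕ)) ∧
      ∀ k l : ℕ, k ≠ l → IsEmpty (G k ≃g G l) := by
  -- An infinite sequence with range `A'`: every prefix of length at least `c` already takes all
  -- values.
  obtain ⟨a, ha⟩ := (Set.to_countable (A' : Set ℕ)).exists_eq_range hne
  have hmem : ∀ j, a j ∈ A' := fun j => by
    rw [← Finset.mem_coe, ha]
    exact Set.mem_range_self j
  obtain ⟨c, hc⟩ : ∃ c, ∀ x ∈ A', ∃ j < c, a j = x := by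
    have : ∀ x : ℕ, ∃ j, x ∈ A' → a j = x := fun x => by
      by_cases hx : x ∈ A'
      · rw [← Finset.mem_coe, ha] at hx
        obtain ⟨j, hj⟩ := hx
        exact ⟨j, fun _ => hj⟩
      · exact ⟨0, fun h => absurd h hx⟩
    choose g hg using this
    exact ⟨A'.sup g + 1, fun x hx => ⟨g x, Nat.lt_succ_of_le (Finset.le_sup hx), hg x hx⟩⟩
  choose G hpoly htype using fun k : ℕ => SimpleGraph.exists_isPolyhedron_commonNeighborType a
    (fun j => hA' _ (hmem j)) (Nat.succ_pos (c + k))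
  refine ⟨_, G, fun k => ⟨hpoly k, ?_⟩, fun k l hkl => ⟨fun e => hkl ?_⟩⟩
  · rw [htype k]
    congr 1
    ext x
    constructor
    · rintro ⟨j, -, rfl⟩
      exact hmem j
    · intro hx
      obtain ⟨j, hj, rfl⟩ := hc x hx
      exact ⟨j, Set.mem_Iio.2 (by omega), rfl⟩
  · have hcard := Fintype.card_congr e.toEquiv
    rw [Fintype.card_fin, Fintype.card_fin] at hcard
    have hmono : Monotone fun m => ∑ j ∈ Finset.range m, a j := fun _ _ h =>
      Finset.sum_le_sum_of_subset (Finset.range_mono h)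
    rcases le_total k l with h | h
    · have := hmono (by omega : (c + k).succ ≤ (c + l).succ)
      dsimp only at this
      omega
    · have := hmono (by omega : (c + l).succ ≤ (c + k).succ)
      dsimp only at this
      omega
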